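/- Let $\xi$ denote Riemann's entire function, i.e. the entire extension of $\xi(s)=\tfrac12 s(s-1)\pi^{-s/2}\Gamma(s/2)\zeta(s)$, and for complex $s,\beta$ set $n(s,\beta):=\sin(\pi s/4)\cdot 2\,\xi(2\beta+s)$. For real $\beta$ and $x$ put, for $t,t_1,t_2\in\mathbb R$, $$m(t):=\left|1-\frac{n(x,\beta)}{n(x+it,\beta)}\right|^{1/2},\qquad d(t_1,t_2):=m(t_1-t_2).$$ Suppose that either (a) $\beta\ge 0$, $x>4$ and $x$ is not an integer multiple of $4$; or (b) $\beta=\tfrac14$, $|x|>4$ and $x$ is not an integer multiple of $4$. Then $n(x+it,\beta)\ne0$ for all real $t$ (so $m$ and $d$ are well defined and finite), and: (1) $m$ is a metric norm on $\mathbb R$, that is, $m(t)\ge 0$ with equality if and only if $t=0$, $m(-t)=m(t)$, and $m(t_1+t_2)\le m(t_1)+m(t_2)$ for all real $t,t_1,t_2$; (2) $d$ is a finite-valued translation-invariant metric on $\mathbb R$. -/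

import Mathlib

namespace CsizmaziaZeta

/-- Riemann's entire function `ξ`. The function `½ s (s - 1) π^(-s/2) Γ(s/2) ζ(s)` has removable
singularities at `0`, `1` and the negative even integers. Mathlib's `completedRiemannZeta₀` is the
entire function with `completedRiemannZeta s = completedRiemannZeta₀ s - 1 / s - 1 / (1 - s)`, so
that the entire extension is the one below; see `xi_eq` and `differentiable_xi`. -/
noncomputable def xi (s : ℂ) : ℂ :=
  (1 / 2) * (s * (s - 1) * completedRiemannZeta₀ s + 1)

theorem differentiable_xi : Differentiable ℂ xi := by
  have h := differentiable_completedZeta₀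
  unfold xi
  fun_prop

/-- Away from the removable singularities `xi` is given by the classical formula. -/
theorem xi_eq (s : ℂ) (h1 : s ≠ 1) (hΓ : ∀ k : ℕ, s ≠ -(2 * (k : ℂ))) :
    xi s = (1 / 2) * (s * (s - 1) * (Real.pi : ℂ) ^ (-s / 2) * Complex.Gamma (s / 2)
      * riemannZeta s) := by
  have h0 : s ≠ 0 := by simpa using hΓ 0
  have hG : Complex.Gammaℝ s ≠ 0 := by
    rw [Ne, Complex.Gammaℝ_eq_zero_iff]
    rintro ⟨k, hk⟩
    exact hΓ k hk
  have h1' : (1 : ℂ) - s ≠ 0 := sub_ne_zero.mpr (Ne.symm h1)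
  have hz : Complex.Gammaℝ s * riemannZeta s = completedRiemannZeta s := by
    rw [riemannZeta_def_of_ne_zero h0]
    field_simp
  rw [Complex.Gammaℝ_def, completedRiemannZeta_eq] at hz
  have : s * (s - 1) * (Real.pi : ℂ) ^ (-s / 2) * Complex.Gamma (s / 2) * riemannZeta s
      = s * (s - 1) * ((Real.pi : ℂ) ^ (-s / 2) * Complex.Gamma (s / 2) * riemannZeta s) := by ring
  rw [this, hz, xi]
  field_simp
  ring

/-- The entire function `n(s, β) = sin(π s / 4) · 2 ξ(2 β + s)`. -/
noncomputable def n (s β : ℂ) : ℂ :=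
  Complex.sin (Real.pi * s / 4) * (2 * xi (2 * β + s))

/-- `m(t) = |1 - n(x, β) / n(x + i t, β)|^(1/2)`. -/
noncomputable def m (x β t : ℝ) : ℝ :=
  ‖1 - n (x : ℂ) (β : ℂ) / n ((x : ℂ) + Complex.I * (t : ℂ)) (β : ℂ)‖ ^ (1 / 2 : ℝ)

/-- `d(t₁, t₂) = m(t₁ - t₂)`. -/
noncomputable def d (x β t₁ t₂ : ℝ) : ℝ := m x β (t₁ - t₂)

/-- The metric assertions for given `x` and `β`: the denominators `n(x + i t, β)` do not vanish, so
that `m` and `d` are well defined and finite; `m` is a norm on the additive group `ℝ` (zero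
exactly at `0`, even and subadditive); and `d` is the distance function of a metric on the set `ℝ`
that is invariant under translations. -/
def MetricAssertions (x β : ℝ) : Prop :=
  (∀ t : ℝ, n ((x : ℂ) + Complex.I * (t : ℂ)) (β : ℂ) ≠ 0) ∧
  (∃ N : AddGroupNorm ℝ, ∀ t : ℝ, N t = m x β t) ∧
  (∃ D : MetricSpace ℝ, ∀ t₁ t₂ : ℝ, D.dist t₁ t₂ = d x β t₁ t₂) ∧
  (∀ t₁ t₂ c : ℝ, d x β (t₁ + c) (t₂ + c) = d x β t₁ t₂)

end CsizmaziaZeta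

open MeasureTheory ProbabilityTheory Set Filter Topology

/-! The point is that `1 / n(x + it, β)` is, up to a constant factor, the Fourier transform of a
finite positive measure. Then `φ(t) = n(x, β) / n(x + it, β)` is the characteristic function of a
probability measure, and `|1 - φ|^(1/2)` is even and subadditive, by Cauchy–Schwarz
(`sqrt_norm_one_sub_add_le`).

For `x > 4` write `x = 4k + 2σ` with `k ≥ 1`, `0 < σ < 2`, and put `u = σ + it/2`, `w = 2β + 4k +
2u`. Up to constants, `1/n` is the product of `1/(w - 1)`, `π^(it/2)`, `Γ(u+3)/Γ(u+3+b)` with `b = β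
+ 2k - 2 ≥ 0`, and `1/(sin(πu/2) Γ(u+3) ζ(w))`. Products of Fourier transforms correspond to
convolutions, so each factor is treated alone: an exponential density, a point mass, a Beta density,
and a Möbius sum.

The last is the crux. `1/(sin(πu/2) Γ(u+3))` is a multiple of a Mellin transform of `fejerDefect ≥
0` (`integral_cpow_mul_fejerDefect`). Expanding `1/ζ` in its Dirichlet series replaces this density
by a signed sum of its dilates, which stays nonnegative because the first term dominates
(`moebiusDensity_nonneg`). The factor `1/(w - 1)` also makes `|φ(t)| < 1` for `t ≠ 0`, whence
definiteness. Negative `x` at `β = 1/4` follows from the functional equation. -/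

namespace CsizmaziaZeta

/-! ### Fourier transforms of finite positive measures -/

/-- `φ` is the Fourier transform of a finite positive measure on `ℝ`. -/
def IsFourierTransform (φ : ℝ → ℂ) : Prop :=
  ∃ ν : Measure ℝ, IsFiniteMeasure ν ∧ ∀ t, φ t = charFun ν t

theorem IsFourierTransform.mul {φ ψ : ℝ → ℂ} (hφ : IsFourierTransform φ)
    (hψ : IsFourierTransform ψ) : IsFourierTransform (fun t => φ t * ψ t) := by
  obtain ⟨μ, _, h1⟩ := hφ
  obtain ⟨ν, _, h2⟩ := hψ
  exact ⟨μ ∗ ν, inferInstance, fun t => by simp only [charFun_conv, h1, h2]⟩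

theorem IsFourierTransform.eq_measureReal {φ : ℝ → ℂ} (hφ : IsFourierTransform φ) :
    ∃ r : ℝ, 0 ≤ r ∧ φ 0 = r := by
  obtain ⟨μ, _, h1⟩ := hφ
  exact ⟨μ.real univ, measureReal_nonneg, by rw [h1, charFun_zero]⟩

theorem IsFourierTransform.const_mul {φ : ℝ → ℂ} (hφ : IsFourierTransform φ) {r : ℝ}
    (hr : 0 ≤ r) : IsFourierTransform (fun t => r * φ t) := by
  obtain ⟨μ, _, h1⟩ := hφ
  refine ⟨r.toNNReal • μ, inferInstance, fun t => ?_⟩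
  simp only [h1]
  rw [charFun_apply, charFun_apply, integral_smul_nnreal_measure, NNReal.smul_def,
    Real.coe_toNNReal _ hr, Complex.real_smul]

theorem IsFourierTransform.norm_le {φ : ℝ → ℂ} (hφ : IsFourierTransform φ) (t : ℝ) :
    ‖φ t‖ ≤ ‖φ 0‖ := by
  obtain ⟨μ, _, h1⟩ := hφ
  rw [h1, h1, charFun_zero]
  simpa [abs_of_nonneg] using norm_charFun_le (μ := μ) t

theorem isFourierTransform_exp (c : ℝ) :
    IsFourierTransform (fun t => Complex.exp (t * c * Complex.I)) :=
  ⟨Measure.dirac c, inferInstance, fun t => by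
    rw [charFun_apply_real]; simp⟩

/-- A nonnegative integrable weight together with a real phase gives a Fourier transform. -/
theorem isFourierTransform_integral {Ω : Type*} [MeasurableSpace Ω] {μ : Measure Ω}
    {f g : Ω → ℝ} (hf : Integrable f μ) (hf0 : 0 ≤ᵐ[μ] f) (hg : Measurable g) :
    IsFourierTransform (fun t => ∫ a, (f a : ℂ) * Complex.exp (t * g a * Complex.I) ∂μ) := by
  have hfin : IsFiniteMeasure (μ.withDensity fun a => ENNReal.ofReal (f a)) :=
    isFiniteMeasure_withDensity_ofReal hf.2
  refine ⟨(μ.withDensity fun a => ENNReal.ofReal (f a)).map g, inferInstance, fun t => ?_⟩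
  rw [charFun_apply_real, integral_map hg.aemeasurable (by fun_prop),
    integral_withDensity_eq_integral_toReal_smul₀ hf.1.aemeasurable.ennreal_ofReal
      (by simp)]
  refine integral_congr_ae ?_
  filter_upwards [hf0] with a ha
  simp [ENNReal.toReal_ofReal ha]

/-! ### From characteristic functions to metric norms -/

/-- Subadditivity of `|1 - φ| ^ (1/2)` for a characteristic function `φ`. -/
theorem sqrt_norm_one_sub_add_le {φ : ℝ → ℂ} (hφ : IsFourierTransform φ) (h0 : φ 0 = 1)
    (s t : ℝ) : √‖1 - φ (s + t)‖ ≤ √‖1 - φ s‖ + √‖1 - φ t‖ := by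
  obtain ⟨ν, _, h⟩ := hφ
  have hν : IsProbabilityMeasure ν := by
    have : ((ν.real univ : ℝ) : ℂ) = 1 := by rw [← charFun_zero, ← h, h0]
    have h' : ν.real univ = 1 := by exact_mod_cast this
    exact isProbabilityMeasure_iff_real.mpr h'
  set e : ℝ → ℝ → ℂ := fun t x => Complex.exp (t * x * Complex.I) with he
  have hcont : ∀ t, Continuous (e t) := fun t => by simp only [he]; fun_prop
  have hnorm : ∀ t x, ‖e t x‖ = 1 := fun t x => by
    simp only [he]
    rw [← Complex.ofReal_mul, Complex.norm_exp_ofReal_mul_I]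
  have hint : ∀ t, Integrable (e t) ν := fun t =>
    Integrable.of_bound (hcont t).aestronglyMeasurable 1 (by simp [hnorm])
  have hφe : ∀ t, 1 - φ t = ∫ x, (1 - e t x) ∂ν := fun t => by
    rw [integral_sub (by simp) (hint t), h, charFun_apply_real]
    simp [he]
  have hb : ∀ t x, ‖1 - e t x‖ ≤ 2 := fun t x => by
    calc ‖1 - e t x‖ ≤ ‖(1 : ℂ)‖ + ‖e t x‖ := norm_sub_le _ _
      _ = 2 := by rw [hnorm]; norm_num
  -- On the unit circle `|1 - z|² = 2 Re(1 - z)`.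
  have hsq : ∀ t, ∫ x, ‖1 - e t x‖ ^ 2 ∂ν ≤ 2 * ‖1 - φ t‖ := fun t => by
    have h1 : ∀ x, ‖1 - e t x‖ ^ 2 = 2 * (1 - e t x).re := fun x => by
      have h2 := hnorm t x
      rw [← sq_eq_sq₀ (norm_nonneg _) zero_le_one, Complex.sq_norm, Complex.normSq_apply] at h2
      rw [Complex.sq_norm, Complex.normSq_apply]
      simp only [Complex.sub_re, Complex.sub_im, Complex.one_re, Complex.one_im]
      linarith
    simp_rw [h1]
    rw [integral_const_mul]
    have h3 : ∫ x, (1 - e t x).re ∂ν = (1 - φ t).re := by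
      rw [hφe]
      exact integral_re ((integrable_const _).sub (hint t))
    rw [h3]
    gcongr
    exact Complex.re_le_norm _
  have hmul : ∫ x, ‖1 - e s x‖ * ‖1 - e t x‖ ∂ν ≤ 2 * (√‖1 - φ s‖ * √‖1 - φ t‖) := by
    have hp : ∀ t, MemLp (fun x => ‖1 - e t x‖) (ENNReal.ofReal 2) ν := fun t =>
      MemLp.of_bound (by have := hcont t; fun_prop) 2 (by simpa using Eventually.of_forall (hb t))
    have := integral_mul_le_Lp_mul_Lq_of_nonneg (μ := ν) Real.HolderConjugate.two_two
      (f := fun x => ‖1 - e s x‖) (g := fun x => ‖1 - e t x‖)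
      (Eventually.of_forall fun x => norm_nonneg _)
      (Eventually.of_forall fun x => norm_nonneg _) (hp s) (hp t)
    refine this.trans ?_
    simp only [Real.rpow_two, ← Real.sqrt_eq_rpow]
    calc _ ≤ √(2 * ‖1 - φ s‖) * √(2 * ‖1 - φ t‖) := by
          gcongr <;> exact hsq _
      _ = _ := by
          rw [Real.sqrt_mul (by norm_num), Real.sqrt_mul (by norm_num)]
          have := Real.mul_self_sqrt (show (0 : ℝ) ≤ 2 by norm_num)
          linear_combination (√‖1 - φ s‖ * √‖1 - φ t‖) * this
  -- Integrated form of `1 - ab = (1 - a) + (1 - b) - (1 - a)(1 - b)`; by `hmul` the product term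
  -- supplies exactly the cross term of the square below.
  have hdecomp : 1 - φ (s + t) = (1 - φ s) + (1 - φ t) - ∫ x, (1 - e s x) * (1 - e t x) ∂ν := by
    have hi : ∀ t, Integrable (fun x => 1 - e t x) ν := fun t =>
      (integrable_const _).sub (hint t)
    rw [hφe, hφe s, hφe t, ← integral_add (hi s) (hi t), 
      ← integral_sub (f := fun x => (1 - e s x) + (1 - e t x)) ((hi s).add (hi t))]
    · congr 1
      ext x
      have : e (s + t) x = e s x * e t x := by
        simp only [he]
        rw [← Complex.exp_add]
        congr 1
        push_cast
        ring
      rw [this]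
      ring
    · refine Integrable.of_bound (C := 2 * 2) ?_ (Eventually.of_forall fun x => ?_)
      · have := hcont t
        have := hcont s
        exact Continuous.aestronglyMeasurable (by fun_prop)
      · rw [norm_mul]
        gcongr <;> exact hb _ _
  have hle : ‖1 - φ (s + t)‖ ≤ (√‖1 - φ s‖ + √‖1 - φ t‖) ^ 2 := by
    have h1 : ‖∫ x, (1 - e s x) * (1 - e t x) ∂ν‖ ≤ 2 * (√‖1 - φ s‖ * √‖1 - φ t‖) := by
      refine (norm_integral_le_integral_norm _).trans ?_
      simpa only [norm_mul] using hmul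
    rw [hdecomp]
    refine (norm_sub_le _ _).trans ?_
    have := norm_add_le (1 - φ s) (1 - φ t)
    rw [add_sq, Real.sq_sqrt (norm_nonneg _), Real.sq_sqrt (norm_nonneg _)]
    linarith
  rw [← Real.sqrt_sq (by positivity : 0 ≤ √‖1 - φ s‖ + √‖1 - φ t‖)]
  exact Real.sqrt_le_sqrt hle

theorem norm_one_sub_neg {φ : ℝ → ℂ} (hφ : IsFourierTransform φ) (t : ℝ) :
    ‖1 - φ (-t)‖ = ‖1 - φ t‖ := by
  obtain ⟨ν, _, h⟩ := hφ
  rw [h, h, charFun_neg, ← Complex.norm_conj (1 - charFun ν t)]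
  simp

/-- The metric assertions follow from positive definiteness of `1 / n(x + i t, β)`. -/
theorem metricAssertions_of_isFourierTransform {x β : ℝ} {P : ℝ → ℂ} {c : ℂ}
    (hP : IsFourierTransform P) (hP1 : ∀ t, t ≠ 0 → ‖P t‖ < ‖P 0‖)
    (hn : ∀ t : ℝ, (n ((x : ℂ) + Complex.I * (t : ℂ)) (β : ℂ))⁻¹ = c * P t)
    (hne : ∀ t : ℝ, n ((x : ℂ) + Complex.I * (t : ℂ)) (β : ℂ) ≠ 0) :
    MetricAssertions x β := by
  have hn0 := hn 0
  simp only [Complex.ofReal_zero, mul_zero, add_zero] at hn0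
  have hne0 := hne 0
  simp only [Complex.ofReal_zero, mul_zero, add_zero] at hne0
  have hcP : c * P 0 ≠ 0 := hn0 ▸ inv_ne_zero hne0
  have hc : c ≠ 0 := left_ne_zero_of_mul hcP
  have hP0 : P 0 ≠ 0 := right_ne_zero_of_mul hcP
  -- `P 0` is the total mass of the measure, hence real and nonnegative, so normalising preserves
  -- positivity.
  have hφ : ∃ φ : ℝ → ℂ, IsFourierTransform φ ∧ (∀ t, φ t = P t / P 0) := by
    obtain ⟨r, hr, hPr⟩ := hP.eq_measureReal
    refine ⟨_, hP.const_mul (inv_nonneg.mpr hr), fun t => ?_⟩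
    rw [hPr]
    push_cast
    ring
  obtain ⟨φ, hφ, hφP⟩ := hφ
  have hφ0 : φ 0 = 1 := by rw [hφP, div_self hP0]
  have hm : ∀ t, m x β t = √‖1 - φ t‖ := fun t => by
    have h1 : n (x : ℂ) β = (c * P 0)⁻¹ := by rw [← hn0, inv_inv]
    rw [m, Real.sqrt_eq_rpow, div_eq_mul_inv, hn t, h1, hφP]
    congr 3
    field_simp
  let N : AddGroupNorm ℝ :=
    { toFun := m x β
      map_zero' := by rw [hm, hφ0]; simp
      add_le' := fun s t => by
        rw [hm, hm, hm]
        exact sqrt_norm_one_sub_add_le hφ hφ0 s t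
      neg' := fun t => by rw [hm, hm, norm_one_sub_neg hφ]
      eq_zero_of_map_eq_zero' := fun t ht => by
        by_contra h
        rw [hm, Real.sqrt_eq_zero (norm_nonneg _), norm_eq_zero, sub_eq_zero, hφP,
          eq_div_iff hP0, one_mul] at ht
        exact absurd (congrArg norm ht) (hP1 t h).ne' }
  -- The distance induced by `N` is `N (-a + b)`; evenness identifies it with `m (a - b)`.
  have hsub : ∀ a b : ℝ, m x β (-a + b) = d x β a b := fun a b => by
    rw [d, hm, hm, ← norm_one_sub_neg hφ]
    congr 4
    ring
  refine ⟨hne, ⟨N, fun t => rfl⟩, ⟨N.toNormedAddCommGroup.toMetricSpace, fun a b => ?_⟩,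
    fun a b c => ?_⟩
  · exact hsub a b
  · simp only [d, add_sub_add_right_eq_sub]

/-! ### Mellin transforms of Laplace transforms -/

theorem ofReal_cpow_eq_rpow_mul_exp {y : ℝ} (hy : 0 < y) (s : ℂ) :
    (y : ℂ) ^ s = ((y ^ s.re : ℝ) : ℂ) * Complex.exp (s.im * Real.log y * Complex.I) := by
  have h : (y : ℂ) ≠ 0 := by exact_mod_cast hy.ne'
  rw [Complex.ofReal_cpow hy.le, Complex.cpow_def_of_ne_zero h, Complex.cpow_def_of_ne_zero h,
    ← Complex.exp_add, ← Complex.ofReal_log hy.le]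
  congr 1
  nth_rewrite 1 [← Complex.re_add_im s]
  ring

theorem integrableOn_cpow_mul_exp_neg_mul {s : ℂ} (hs : 0 < s.re) {y : ℝ} (hy : 0 < y) :
    IntegrableOn (fun p : ℝ => (p : ℂ) ^ (s - 1) * Complex.exp (-(y * p))) (Ioi 0) := by
  have := Complex.GammaIntegral_convergent hs
  rw [← mul_zero y, ← integrableOn_Ioi_comp_mul_left_iff _ _ hy] at this
  have h := Integrable.const_mul this ((y : ℂ) ^ (-(s - 1)))
  refine IntegrableOn.congr_fun h (fun p hp => ?_) measurableSet_Ioi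
  simp only [mem_Ioi] at hp
  have hy' : (y : ℂ) ≠ 0 := by exact_mod_cast hy.ne'
  simp only [Complex.ofReal_mul, Complex.mul_cpow_ofReal_nonneg hy.le hp.le, Complex.ofReal_neg,
    Complex.ofReal_exp, Complex.cpow_neg]
  have : (y : ℂ) ^ (s - 1) ≠ 0 := by simp [Complex.cpow_eq_zero_iff, hy']
  field_simp

/-- The Mellin transform of a Laplace transform. -/
theorem mellin_laplace {g : ℝ → ℝ} {G : ℝ → ℂ} {s : ℂ} (hs : 0 < s.re) (hg : Measurable g)
    (hint : IntegrableOn (fun y => y ^ (-s.re) * g y) (Ioi 0))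
    (hG : ∀ p : ℝ, 0 < p → ∫ y in Ioi (0 : ℝ), (g y : ℂ) * Complex.exp (-(y * p)) = G p) :
    mellin G s = Complex.Gamma s * ∫ y in Ioi (0 : ℝ), (y : ℂ) ^ (-s) * g y := by
  have hgam : ∀ y : ℝ, 0 < y → ∫ p in Ioi (0 : ℝ), (p : ℂ) ^ (s - 1) * Complex.exp (-(y * p))
      = (y : ℂ) ^ (-s) * Complex.Gamma s := fun y hy => by
    rw [Complex.integral_cpow_mul_exp_neg_mul_Ioi hs hy, one_div, Complex.inv_cpow,
      Complex.cpow_neg]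
    rw [Complex.arg_ofReal_of_nonneg hy.le]
    exact Real.pi_pos.ne
  have hnorm : ∀ y : ℝ, 0 < y → ∀ p : ℝ, 0 < p → ‖(p : ℂ) ^ (s - 1) * Complex.exp (-(y * p))‖
      = p ^ (s.re - 1) * Real.exp (-(y * p)) := fun y hy p hp => by
    rw [norm_mul, Complex.norm_cpow_eq_rpow_re_of_pos hp, Complex.norm_exp]
    simp
  have hmeas : Measurable (fun z : ℝ × ℝ =>
      (z.2 : ℂ) ^ (s - 1) * Complex.exp (-(z.1 * z.2)) * (g z.1 : ℂ)) := by
    have h1 : Measurable fun z : ℝ × ℝ => g z.1 := hg.comp measurable_fst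
    have h2 : Measurable fun z : ℝ × ℝ => (z.2 : ℂ) ^ (s - 1) :=
      (Complex.measurable_ofReal.comp measurable_snd).pow_const _
    fun_prop
  -- Fubini applies because the `p`-integral of the norm is `Γ(Re s) y^(-Re s) |g y|`, integrable by
  -- `hint`.
  have hprod : Integrable (Function.uncurry fun y p : ℝ =>
      (p : ℂ) ^ (s - 1) * Complex.exp (-(y * p)) * (g y : ℂ))
      ((volume.restrict (Ioi 0)).prod (volume.restrict (Ioi 0))) := by
    refine (integrable_prod_iff hmeas.aestronglyMeasurable).mpr ⟨?_, ?_⟩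
    · filter_upwards [ae_restrict_mem measurableSet_Ioi] with y hy
      exact Integrable.mul_const (integrableOn_cpow_mul_exp_neg_mul hs hy) _
    · have h2 : Integrable (fun y => Real.Gamma s.re * ‖y ^ (-s.re) * g y‖)
        (volume.restrict (Ioi 0)) := hint.norm.const_mul _
      refine h2.congr ?_
      filter_upwards [ae_restrict_mem measurableSet_Ioi] with y (hy : 0 < y)
      have : ∀ p ∈ Ioi (0 : ℝ), ‖(p : ℂ) ^ (s - 1) * Complex.exp (-(y * p)) * (g y : ℂ)‖
          = p ^ (s.re - 1) * Real.exp (-(y * p)) * |g y| := fun p hp => by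
        rw [norm_mul, hnorm y hy p hp, Complex.norm_real, Real.norm_eq_abs]
      rw [setIntegral_congr_fun measurableSet_Ioi this, integral_mul_const,
        Real.integral_rpow_mul_exp_neg_mul_Ioi hs hy, norm_mul, Real.norm_eq_abs, Real.norm_eq_abs,
        abs_of_pos (Real.rpow_pos_of_pos hy _), one_div, Real.inv_rpow hy.le, Real.rpow_neg hy.le]
      ring
  have hswap := integral_integral_swap hprod
  have hL : ∫ y in Ioi (0 : ℝ), ∫ p in Ioi (0 : ℝ),
      (p : ℂ) ^ (s - 1) * Complex.exp (-(y * p)) * (g y : ℂ)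
      = Complex.Gamma s * ∫ y in Ioi (0 : ℝ), (y : ℂ) ^ (-s) * g y := by
    rw [← integral_const_mul]
    refine setIntegral_congr_fun measurableSet_Ioi fun y hy => ?_
    rw [integral_mul_const, hgam y hy]
    ring
  rw [← hL, hswap, mellin]
  refine setIntegral_congr_fun measurableSet_Ioi fun p hp => ?_
  simp only [smul_eq_mul]
  rw [← hG p hp, ← integral_const_mul]
  refine setIntegral_congr_fun measurableSet_Ioi fun y hy => ?_
  ring

/-- `1/(1 + p)` is the Laplace transform of `e^(-y)`, so `mellin_laplace` yields `Γ(s) Γ(1 - s)`,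
and the reflection formula finishes. -/
theorem mellin_one_div_one_add {s : ℂ} (h0 : 0 < s.re) (h1 : s.re < 1) :
    mellin (fun p : ℝ => 1 / (1 + (p : ℂ))) s = Real.pi / Complex.sin (Real.pi * s) := by
  have hG : Complex.Gamma (1 - s) = ∫ y in Ioi (0 : ℝ), (y : ℂ) ^ (-s) * (Real.exp (-y) : ℝ) := by
    rw [Complex.Gamma_eq_integral (by simpa using h1), Complex.GammaIntegral]
    refine setIntegral_congr_fun measurableSet_Ioi fun y hy => ?_
    rw [mul_comm, show (1 - s - 1 : ℂ) = -s by ring]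
  rw [← Complex.Gamma_mul_Gamma_one_sub, hG]
  refine mellin_laplace h0 (by fun_prop) ?_ fun p hp => ?_
  · have := Real.GammaIntegral_convergent (s := 1 - s.re) (by linarith)
    refine this.congr_fun (fun y hy => ?_) measurableSet_Ioi
    rw [mul_comm, show (1 - s.re - 1 : ℝ) = -s.re by ring]
  · have := integral_exp_mul_complex_Ioi (a := -(1 + p : ℂ)) (by simp; linarith) 0
    simp only [Complex.ofReal_zero, mul_zero, Complex.exp_zero] at this
    rw [neg_div_neg_eq] at this
    rw [← this]
    refine setIntegral_congr_fun measurableSet_Ioi fun y hy => ?_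
    rw [Complex.ofReal_exp, ← Complex.exp_add]
    congr 1
    push_cast
    ring

theorem mellin_one_div_one_add_sq {u : ℂ} (h0 : 0 < u.re) (h1 : u.re < 2) :
    mellin (fun p : ℝ => 1 / (1 + (p : ℂ) ^ 2)) u
      = Real.pi / (2 * Complex.sin (Real.pi * u / 2)) := by
  have h := mellin_comp_rpow (fun p : ℝ => 1 / (1 + (p : ℂ))) u 2
  simp only [Real.rpow_two, Complex.ofReal_pow] at h
  rw [h, Complex.ofReal_ofNat, mellin_one_div_one_add]
  · rw [Complex.real_smul, mul_div_assoc]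
    norm_num
    field_simp
  · simpa using h0
  · simp
    linarith

/-! ### The Fejér defect and its Mellin transform -/

/-- The function `½ (1 - sinc² (y / 2))`, i.e. half the defect of the Fejér kernel. -/
noncomputable def fejerDefect (y : ℝ) : ℝ := 1 / 2 - (1 - Real.cos y) / y ^ 2

theorem measurable_fejerDefect : Measurable fejerDefect := by
  unfold fejerDefect
  fun_prop

theorem continuousOn_fejerDefect : ContinuousOn fejerDefect (Ioi 0) := by
  unfold fejerDefect
  refine ContinuousOn.sub (by fun_prop) (ContinuousOn.div (by fun_prop) (by fun_prop) ?_)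
  intro y hy
  exact pow_ne_zero _ (ne_of_gt hy)

theorem fejerDefect_nonneg {y : ℝ} (hy : 0 < y) : 0 ≤ fejerDefect y := by
  have h := Real.one_sub_sq_div_two_le_cos (x := y)
  rw [fejerDefect, sub_nonneg, div_le_iff₀ (by positivity)]
  linarith

theorem fejerDefect_le_half (y : ℝ) : fejerDefect y ≤ 1 / 2 := by
  have h := Real.cos_le_one y
  have : 0 ≤ (1 - Real.cos y) / y ^ 2 := div_nonneg (by linarith) (by positivity)
  rw [fejerDefect]
  linarith

theorem fejerDefect_eq {x : ℝ} (hx : 0 < x) :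
    fejerDefect (2 * x) = (x ^ 2 - Real.sin x ^ 2) / (2 * x ^ 2) := by
  rw [fejerDefect, Real.cos_two_mul, Real.cos_sq']
  field_simp
  ring

theorem fejerDefect_le_sq {y : ℝ} (hy : 0 < y) : fejerDefect y ≤ y ^ 2 / 8 := by
  rcases le_or_gt y 2 with h | h
  · obtain ⟨x, rfl⟩ : ∃ x, y = 2 * x := ⟨y / 2, by ring⟩
    have hx : 0 < x := by linarith
    have h1 := Real.sin_gt_sub_cube hx
    have h2 : 0 ≤ x - x ^ 3 / 6 := by nlinarith [sq_nonneg x]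
    have h3 : (x - x ^ 3 / 6) ^ 2 ≤ Real.sin x ^ 2 := by gcongr
    rw [fejerDefect_eq hx, div_le_iff₀ (by positivity)]
    nlinarith [pow_pos hx 4, pow_pos hx 6]
  · refine (fejerDefect_le_half y).trans ?_
    nlinarith

/-- With `S = sin²(x/2) ≤ (x/2)²`, one has `sin² x = 4S(1 - S) ≤ x²(1 - S)`, so `x² - sin² x ≥ x²
S`; Jordan's inequality then gives `S ≥ (x/π)²`. -/
theorem le_fejerDefect {x : ℝ} (hx : 0 < x) (hxπ : x ≤ Real.pi) :
    x ^ 2 / (2 * Real.pi ^ 2) ≤ fejerDefect (2 * x) := by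
  have h1 : 2 / Real.pi * (x / 2) ≤ Real.sin (x / 2) :=
    Real.mul_le_sin (by linarith) (by linarith)
  have h1' : (x / Real.pi) ^ 2 ≤ Real.sin (x / 2) ^ 2 := by
    have : x / Real.pi = 2 / Real.pi * (x / 2) := by ring
    have h0 : 0 ≤ x / Real.pi := div_nonneg hx.le Real.pi_pos.le
    rw [this] at h0 ⊢
    gcongr
  have h2 : Real.sin x ^ 2 = 4 * Real.sin (x / 2) ^ 2 * (1 - Real.sin (x / 2) ^ 2) := by
    have : x = 2 * (x / 2) := by ring
    rw [this, Real.sin_two_mul, ← Real.cos_sq']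
    ring_nf
  have h3 : Real.sin (x / 2) ^ 2 ≤ (x / 2) ^ 2 := by
    have := Real.sin_le (show 0 ≤ x / 2 by linarith)
    have h0 : 0 ≤ Real.sin (x / 2) := Real.sin_nonneg_of_nonneg_of_le_pi (by linarith)
      (by linarith)
    gcongr
  have h4 : 0 ≤ 1 - Real.sin (x / 2) ^ 2 := by linarith [Real.sin_sq_le_one (x / 2)]
  rw [fejerDefect_eq hx, le_div_iff₀ (by positivity), h2]
  have h5 : x ^ 2 / (2 * Real.pi ^ 2) * (2 * x ^ 2) = x ^ 2 * (x / Real.pi) ^ 2 := by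
    field_simp
  rw [h5]
  have h6 := mul_le_mul_of_nonneg_left h1' (sq_nonneg x)
  have h7 := mul_le_mul_of_nonneg_right h3 h4
  nlinarith

/-- `fejerDefect` is increasing up to a factor `2`, at scales at least `4`. -/
theorem fejerDefect_div_le {y N : ℝ} (hy : 0 < y) (hN : 4 ≤ N) :
    fejerDefect (y / N) ≤ 2 * fejerDefect y := by
  have hπ := Real.pi_pos
  have hπ2 : Real.pi ^ 2 < 10 := by nlinarith [Real.pi_lt_d2]
  have hπ3 := Real.pi_gt_three
  -- Up to `2π` the quadratic bounds compare as `y²/128 ≤ 2 · y²/80`; beyond it `fejerDefect y ≥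
  -- 1/4`, while `1/2` bounds the left side.
  rcases le_or_gt y (2 * Real.pi) with h | h
  · have h1 := le_fejerDefect (x := y / 2) (by linarith) (by linarith)
    have h2 := fejerDefect_le_sq (y := y / N) (by positivity)
    have h3 : (y / N) ^ 2 ≤ (y / 4) ^ 2 := by gcongr
    have h4 : (y / 2) ^ 2 / 20 ≤ (y / 2) ^ 2 / (2 * Real.pi ^ 2) := by
      gcongr
      linarith
    rw [mul_div_cancel₀ _ (two_ne_zero)] at h1
    nlinarith [sq_nonneg y]
  · have h1 := fejerDefect_le_half (y / N)
    have h2 : (1 - Real.cos y) / y ^ 2 ≤ 1 / 4 := by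
      rw [div_le_iff₀ (by positivity)]
      nlinarith [Real.neg_one_le_cos y]
    have : fejerDefect y = 1 / 2 - (1 - Real.cos y) / y ^ 2 := rfl
    linarith

/-- Quadratic vanishing at `0` requires `σ < 2`; boundedness at infinity requires `0 < σ`. -/
theorem integrableOn_rpow_mul_fejerDefect {σ : ℝ} (h0 : 0 < σ) (h2 : σ < 2) :
    IntegrableOn (fun y => y ^ (-σ - 1) * fejerDefect y) (Ioi 0) := by
  have hm : Measurable fun y => y ^ (-σ - 1) * fejerDefect y :=
    (measurable_id.pow_const _).mul measurable_fejerDefect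
  rw [← Ioc_union_Ioi_eq_Ioi zero_le_one]
  refine IntegrableOn.union ?_ ?_
  · have h : IntegrableOn (fun y : ℝ => y ^ (1 - σ)) (Ioc 0 1) := by
      rw [← intervalIntegrable_iff_integrableOn_Ioc_of_le zero_le_one]
      exact intervalIntegral.intervalIntegrable_rpow' (by linarith)
    refine Integrable.mono' h hm.aestronglyMeasurable ?_
    filter_upwards [ae_restrict_mem measurableSet_Ioc] with y hy
    have hy0 : 0 < y := hy.1
    rw [norm_mul, Real.norm_of_nonneg (by positivity),
      Real.norm_of_nonneg (fejerDefect_nonneg hy0)]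
    have h3 : y ^ (1 - σ) = y ^ (-σ - 1) * y ^ 2 := by
      rw [← Real.rpow_natCast y 2, ← Real.rpow_add hy0]
      congr 1
      push_cast
      ring
    rw [h3]
    gcongr
    exact (fejerDefect_le_sq hy0).trans (by nlinarith [sq_nonneg y])
  · have h : IntegrableOn (fun y : ℝ => y ^ (-σ - 1)) (Ioi 1) :=
      integrableOn_Ioi_rpow_of_lt (by linarith) one_pos
    refine Integrable.mono' h hm.aestronglyMeasurable ?_
    filter_upwards [ae_restrict_mem measurableSet_Ioi] with y hy
    have hy0 : 0 < y := one_pos.trans hy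
    rw [norm_mul, Real.norm_of_nonneg (by positivity),
      Real.norm_of_nonneg (fejerDefect_nonneg hy0)]
    refine mul_le_of_le_one_right (by positivity) ?_
    linarith [fejerDefect_le_half y]

theorem laplace_sq_sub_one_add_cos {p : ℝ} (hp : 0 < p) :
    ∫ y in Ioi (0 : ℝ), ((y ^ 2 / 2 - 1 + Real.cos y : ℝ) : ℂ) * Complex.exp (-(y * p))
      = 1 / ((p : ℂ) ^ 3 * (1 + (p : ℂ) ^ 2)) := by
  have hpc : (p : ℂ) ≠ 0 := by exact_mod_cast hp.ne'
  have hexp : ∀ a : ℂ, a.re < 0 → ∫ y in Ioi (0 : ℝ), Complex.exp (a * y) = -1 / a := fun a ha => by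
    rw [integral_exp_mul_complex_Ioi ha]
    simp
  have i1 : IntegrableOn (fun y : ℝ => (1 / 2 : ℂ) *
      ((y : ℂ) ^ ((3 : ℂ) - 1) * Complex.exp (-(p * y)))) (Ioi 0) :=
    Integrable.const_mul (integrableOn_cpow_mul_exp_neg_mul (by norm_num) hp) _
  have i2 : IntegrableOn (fun y : ℝ => Complex.exp (-p * y)) (Ioi 0) :=
    integrableOn_exp_mul_complex_Ioi (by simpa using hp) 0
  have i3 : IntegrableOn (fun y : ℝ => (1 / 2 : ℂ) * Complex.exp ((-p + Complex.I) * y)) (Ioi 0) :=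
    Integrable.const_mul (integrableOn_exp_mul_complex_Ioi (by simpa using hp) 0) _
  have i4 : IntegrableOn (fun y : ℝ => (1 / 2 : ℂ) * Complex.exp ((-p - Complex.I) * y)) (Ioi 0) :=
    Integrable.const_mul (integrableOn_exp_mul_complex_Ioi (by simpa using hp) 0) _
  have key : ∀ y ∈ Ioi (0 : ℝ),
      ((y ^ 2 / 2 - 1 + Real.cos y : ℝ) : ℂ) * Complex.exp (-(y * p))
      = ((1 / 2 : ℂ) * ((y : ℂ) ^ ((3 : ℂ) - 1) * Complex.exp (-(p * y)))
        - Complex.exp (-p * y)) + ((1 / 2 : ℂ) * Complex.exp ((-p + Complex.I) * y)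
        + (1 / 2 : ℂ) * Complex.exp ((-p - Complex.I) * y)) := fun y hy => by
    have e2 : (y : ℂ) ^ ((3 : ℂ) - 1) = (y : ℂ) ^ 2 := by norm_num
    have e3 : Complex.exp ((-p + Complex.I) * y)
        = Complex.exp (-(y * p)) * Complex.exp (y * Complex.I) := by
      rw [← Complex.exp_add]; ring_nf
    have e4 : Complex.exp ((-p - Complex.I) * y)
        = Complex.exp (-(y * p)) * Complex.exp (-y * Complex.I) := by
      rw [← Complex.exp_add]; ring_nf
    have e5 : Complex.exp (-(p * y)) = Complex.exp (-(y * p)) := by ring_nf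
    have e6 : Complex.exp (-p * y) = Complex.exp (-(y * p)) := by ring_nf
    rw [e2, e3, e4, e5, e6]
    push_cast
    rw [Complex.cos]
    ring
  rw [setIntegral_congr_fun measurableSet_Ioi key]
  refine (integral_add' (i1.sub i2) (i3.add i4)).trans ?_
  rw [integral_sub' i1 i2, integral_add' i3 i4,
    integral_const_mul, integral_const_mul, integral_const_mul,
    Complex.integral_cpow_mul_exp_neg_mul_Ioi (by norm_num) hp,
    hexp _ (by simpa using hp), hexp _ (by simpa using hp), hexp _ (by simpa using hp)]
  have g3 : Complex.Gamma 3 = 2 := by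
    simp
  have c3 : (1 / (p : ℂ)) ^ (3 : ℂ) = (1 / p) ^ 3 := by
    rw [← Complex.cpow_natCast]; norm_num
  have n1 : (-p + Complex.I : ℂ) ≠ 0 := fun h => by
    have := congrArg Complex.im h; simp at this
  have n2 : (-p - Complex.I : ℂ) ≠ 0 := fun h => by
    have := congrArg Complex.im h; simp at this
  have n3 : (1 + (p : ℂ) ^ 2) = (-p + Complex.I) * (-p - Complex.I) := by
    linear_combination Complex.I_sq
  rw [g3, c3, n3]
  field_simp
  have hI := Complex.I_sq
  ring_nf
  simp only [hI]
  ring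

/-- `y² fejerDefect y = y²/2 - 1 + cos y` has Laplace transform `1/(p³(1 + p²))`. Taking the Mellin
transform at `u + 3` cancels `p³` and leaves that of `1/(1 + p²)` at `u`. -/
theorem integral_cpow_mul_fejerDefect {u : ℂ} (h0 : 0 < u.re) (h2 : u.re < 2) :
    ∫ y in Ioi (0 : ℝ), (y : ℂ) ^ (-u - 1) * fejerDefect y
      = Real.pi / (2 * Complex.sin (Real.pi * u / 2) * Complex.Gamma (u + 3)) := by
  have hre : (u + 3).re = u.re + 3 := by simp
  have hT : ∀ y : ℝ, 0 < y → y ^ 2 / 2 - 1 + Real.cos y = y ^ 2 * fejerDefect y := fun y hy => by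
    rw [fejerDefect]
    field_simp
    ring
  have h := mellin_laplace (s := u + 3) (g := fun y => y ^ 2 / 2 - 1 + Real.cos y)
    (by rw [hre]; linarith) (by fun_prop) ?_ fun p hp => laplace_sq_sub_one_add_cos hp
  · have hM : mellin (fun p : ℝ => 1 / ((p : ℂ) ^ 3 * (1 + (p : ℂ) ^ 2))) (u + 3)
        = mellin (fun p : ℝ => 1 / (1 + (p : ℂ) ^ 2)) u := by
      refine setIntegral_congr_fun measurableSet_Ioi fun p hp => ?_
      have hpc : (p : ℂ) ≠ 0 := by exact_mod_cast (ne_of_gt hp)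
      have : (p : ℂ) ^ (u + 3 - 1) = (p : ℂ) ^ (u - 1) * (p : ℂ) ^ 3 := by
        rw [← Complex.cpow_natCast _ 3, ← Complex.cpow_add _ _ hpc]
        congr 1
        push_cast
        ring
      simp only [smul_eq_mul]
      rw [this]
      field_simp
    have hR : ∫ y in Ioi (0 : ℝ), (y : ℂ) ^ (-(u + 3)) * ((y ^ 2 / 2 - 1 + Real.cos y : ℝ) : ℂ)
        = ∫ y in Ioi (0 : ℝ), (y : ℂ) ^ (-u - 1) * fejerDefect y := by
      refine setIntegral_congr_fun measurableSet_Ioi fun y hy => ?_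
      have hyc : (y : ℂ) ≠ 0 := by exact_mod_cast (ne_of_gt hy)
      have : (y : ℂ) ^ (-u - 1) = (y : ℂ) ^ (-(u + 3)) * (y : ℂ) ^ 2 := by
        rw [← Complex.cpow_natCast _ 2, ← Complex.cpow_add _ _ hyc]
        congr 1
        push_cast
        ring
      rw [this, hT y hy]
      push_cast
      ring
    have hG : Complex.Gamma (u + 3) ≠ 0 :=
      Complex.Gamma_ne_zero_of_re_pos (by rw [hre]; linarith)
    rw [hM, mellin_one_div_one_add_sq h0 h2, hR] at h
    rw [← div_div, eq_div_iff hG, h, mul_comm]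
  · refine (integrableOn_rpow_mul_fejerDefect h0 h2).congr_fun (fun y hy => ?_) measurableSet_Ioi
    have : y ^ (-u.re - 1) = y ^ (-(u + 3).re) * y ^ 2 := by
      rw [← Real.rpow_natCast y 2, ← Real.rpow_add hy, hre]
      congr 1
      push_cast
      ring
    beta_reduce
    rw [this, hT y hy]
    ring

/-! ### The Möbius sum and the reciprocal zeta factor -/

/-- The density whose Mellin transform is `π / (2 sin(π u / 2) Γ(u + 3) ζ(c + 2 u))` at `-u`. -/
noncomputable def moebiusDensity (c y : ℝ) : ℝ :=
  ∑' k : ℕ, (ArithmeticFunction.moebius k : ℝ) * (k : ℝ) ^ (-c) * fejerDefect (y / (k : ℝ) ^ 2)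

theorem abs_moebius_mul_rpow_le {c : ℝ} (hc : 4 ≤ c) (k : ℕ) :
    |(ArithmeticFunction.moebius k : ℝ) * (k : ℝ) ^ (-c)| ≤ 1 / (k : ℝ) ^ 4 := by
  rcases Nat.eq_zero_or_pos k with rfl | hk
  · simp
  have hk1 : (1 : ℝ) ≤ k := by exact_mod_cast hk
  have h1 : |(ArithmeticFunction.moebius k : ℝ)| ≤ 1 := by
    exact_mod_cast ArithmeticFunction.abs_moebius_le_one (n := k)
  have h2 : (k : ℝ) ^ (-c) ≤ 1 / (k : ℝ) ^ 4 := by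
    calc (k : ℝ) ^ (-c) ≤ (k : ℝ) ^ (-(4 : ℝ)) :=
          Real.rpow_le_rpow_of_exponent_le hk1 (by linarith)
      _ = 1 / (k : ℝ) ^ 4 := by
          rw [Real.rpow_neg (by positivity), one_div]
          norm_cast
  rw [abs_mul, abs_of_nonneg (by positivity : 0 ≤ (k : ℝ) ^ (-c))]
  calc _ ≤ 1 * (k : ℝ) ^ (-c) := by gcongr
    _ ≤ _ := by rwa [one_mul]

theorem fejerDefect_div_sq_le {y : ℝ} (hy : 0 < y) {k : ℕ} (hk : 0 < k) :
    fejerDefect (y / (k : ℝ) ^ 2) ≤ 2 * fejerDefect y := by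
  rcases Nat.lt_or_ge 1 k with h | h
  · have : (2 : ℝ) ≤ k := by exact_mod_cast h
    exact fejerDefect_div_le hy (by nlinarith)
  · obtain rfl : k = 1 := by omega
    have := fejerDefect_nonneg hy
    norm_num
    linarith

theorem abs_moebiusDensity_term_le {c : ℝ} (hc : 4 ≤ c) {y : ℝ} (hy : 0 < y) (k : ℕ) :
    |(ArithmeticFunction.moebius k : ℝ) * (k : ℝ) ^ (-c) * fejerDefect (y / (k : ℝ) ^ 2)|
      ≤ 1 / (k : ℝ) ^ 4 * (2 * fejerDefect y) := by
  rcases Nat.eq_zero_or_pos k with rfl | hk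
  · simp
  have h0 : 0 ≤ fejerDefect (y / (k : ℝ) ^ 2) := fejerDefect_nonneg (by positivity)
  rw [abs_mul, abs_of_nonneg h0]
  exact mul_le_mul (abs_moebius_mul_rpow_le hc k) (fejerDefect_div_sq_le hy hk) h0 (by positivity)

theorem summable_moebiusDensity {c : ℝ} (hc : 4 ≤ c) {y : ℝ} (hy : 0 < y) :
    Summable fun k : ℕ => (ArithmeticFunction.moebius k : ℝ) * (k : ℝ) ^ (-c)
      * fejerDefect (y / (k : ℝ) ^ 2) :=
  Summable.of_norm_bounded (hasSum_zeta_four.summable.mul_right (2 * fejerDefect y))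
    (abs_moebiusDensity_term_le hc hy)

theorem abs_moebiusDensity_le {c : ℝ} (hc : 4 ≤ c) {y : ℝ} (hy : 0 < y) :
    |moebiusDensity c y| ≤ Real.pi ^ 4 / 90 * (2 * fejerDefect y) :=
  tsum_of_norm_bounded (f := fun k : ℕ => (ArithmeticFunction.moebius k : ℝ) * (k : ℝ) ^ (-c)
    * fejerDefect (y / (k : ℝ) ^ 2)) (hasSum_zeta_four.mul_right _) (abs_moebiusDensity_term_le hc hy)

/-- The `k = 1` term is `fejerDefect y`, and the terms with `k ≥ 2` total at most `2(π⁴/90 - 1)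
fejerDefect y` in absolute value, where `2(π⁴/90 - 1) < 1`. -/
theorem moebiusDensity_nonneg {c : ℝ} (hc : 4 ≤ c) {y : ℝ} (hy : 0 < y) :
    0 ≤ moebiusDensity c y := by
  have hT := fejerDefect_nonneg hy
  -- Two terms are split off: `k = 0`, which vanishes since `μ(0) = 0`, and `k = 1`.
  have hsplit := (summable_moebiusDensity hc hy).sum_add_tsum_nat_add 2
  have hz := (hasSum_nat_add_iff' 2).mpr hasSum_zeta_four
  have htail := tsum_of_norm_bounded (f := fun k : ℕ =>
    (ArithmeticFunction.moebius (k + 2) : ℝ) * ((k + 2 : ℕ) : ℝ) ^ (-c)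
      * fejerDefect (y / ((k + 2 : ℕ) : ℝ) ^ 2)) (hz.mul_right (2 * fejerDefect y))
    fun k => abs_moebiusDensity_term_le hc hy (k + 2)
  rw [moebiusDensity, ← hsplit]
  have h1 := (abs_le.mp htail).1
  have hπ : Real.pi ^ 4 ≤ 100 := by
    have hπ2 : Real.pi ^ 2 ≤ 10 := by nlinarith [Real.pi_lt_d2, Real.pi_pos]
    nlinarith [sq_nonneg Real.pi]
  simp [Finset.sum_range_succ] at h1 ⊢
  nlinarith

theorem continuousOn_moebiusDensity {c : ℝ} (hc : 4 ≤ c) :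
    ContinuousOn (moebiusDensity c) (Ioi 0) := by
  refine continuousOn_tsum (u := fun k : ℕ => 1 / (k : ℝ) ^ 4 * 1) (fun k => ?_)
    (hasSum_zeta_four.summable.mul_right 1) fun k y hy => ?_
  · rcases Nat.eq_zero_or_pos k with rfl | hk
    · simpa using continuousOn_const
    refine continuousOn_const.mul (continuousOn_fejerDefect.comp (by fun_prop) fun y hy => ?_)
    have : (0 : ℝ) < y := hy
    exact div_pos this (by positivity)
  · refine (abs_moebiusDensity_term_le hc hy k).trans ?_
    gcongr
    linarith [fejerDefect_le_half y]

theorem integrableOn_rpow_mul_moebiusDensity {c σ : ℝ} (hc : 4 ≤ c) (h0 : 0 < σ) (h2 : σ < 2) :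
    IntegrableOn (fun y => y ^ (-σ - 1) * moebiusDensity c y) (Ioi 0) := by
  have hm : AEStronglyMeasurable (fun y => y ^ (-σ - 1) * moebiusDensity c y)
      (volume.restrict (Ioi 0)) := by
    refine ContinuousOn.aestronglyMeasurable (ContinuousOn.mul (fun y hy => ?_)
      (continuousOn_moebiusDensity hc)) measurableSet_Ioi
    exact (Real.continuousAt_rpow_const _ _ (Or.inl (ne_of_gt hy))).continuousWithinAt
  refine Integrable.mono' ((integrableOn_rpow_mul_fejerDefect h0 h2).const_mul
    (Real.pi ^ 4 / 90 * 2)) hm ?_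
  filter_upwards [ae_restrict_mem measurableSet_Ioi] with y (hy : 0 < y)
  rw [norm_mul, Real.norm_of_nonneg (by positivity)]
  calc _ ≤ y ^ (-σ - 1) * (Real.pi ^ 4 / 90 * (2 * fejerDefect y)) := by
        gcongr
        exact abs_moebiusDensity_le hc hy
    _ = _ := by ring

/-- Dilating by `k²` multiplies the Mellin integral by `k^(-2u)`, so termwise integration produces
`∑ μ(k) k^(-c-2u) = 1/ζ(c + 2u)`. -/
theorem integral_cpow_mul_moebiusDensity {c : ℝ} {u : ℂ} (hc : 4 ≤ c) (h0 : 0 < u.re)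
    (h2 : u.re < 2) :
    ∫ y in Ioi (0 : ℝ), (y : ℂ) ^ (-u - 1) * moebiusDensity c y
      = Real.pi / (2 * Complex.sin (Real.pi * u / 2) * Complex.Gamma (u + 3))
        / riemannZeta (c + 2 * u) := by
  set a : ℕ → ℝ := fun k => (ArithmeticFunction.moebius k : ℝ) * (k : ℝ) ^ (-c) with ha
  set K : ℂ := Real.pi / (2 * Complex.sin (Real.pi * u / 2) * Complex.Gamma (u + 3)) with hK
  let F : ℕ → ℝ → ℂ := fun k y => (y : ℂ) ^ (-u - 1) * ((a k * fejerDefect (y / (k : ℝ) ^ 2) : ℝ) : ℂ)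
  have hbound : ∀ k : ℕ, ∀ y : ℝ, 0 < y →
      ‖F k y‖ ≤ 1 / (k : ℝ) ^ 4 * 2 * (y ^ (-u.re - 1) * fejerDefect y) := fun k y hy => by
    simp only [F]
    rw [norm_mul, Complex.norm_cpow_eq_rpow_re_of_pos hy, Complex.norm_real, Real.norm_eq_abs]
    calc _ ≤ y ^ (-u - 1).re * (1 / (k : ℝ) ^ 4 * (2 * fejerDefect y)) := by
          gcongr
          exact abs_moebiusDensity_term_le hc hy k
      _ = _ := by
          simp only [Complex.sub_re, Complex.neg_re, Complex.one_re]
          ring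
  have hmeas : ∀ k, Measurable (F k) := fun k => by
    have h1 : Measurable fun y : ℝ => (y : ℂ) ^ (-u - 1) := Complex.measurable_ofReal.pow_const _
    have h2 : Measurable fun y : ℝ => fejerDefect (y / (k : ℝ) ^ 2) :=
      measurable_fejerDefect.comp (by fun_prop)
    simp only [F]
    fun_prop
  have hT := integrableOn_rpow_mul_fejerDefect h0 h2
  have hFint : ∀ k, Integrable (F k) (volume.restrict (Ioi 0)) := fun k => by
    refine Integrable.mono' (hT.const_mul (1 / (k : ℝ) ^ 4 * 2)) (hmeas k).aestronglyMeasurable ?_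
    filter_upwards [ae_restrict_mem measurableSet_Ioi] with y hy
    exact hbound k y hy
  have hFsum : Summable fun k => ∫ y in Ioi (0 : ℝ), ‖F k y‖ := by
    refine Summable.of_nonneg_of_le (fun k => integral_nonneg fun y => norm_nonneg _) (fun k => ?_)
      ((hasSum_zeta_four.summable.mul_right 2).mul_right
        (∫ y in Ioi (0 : ℝ), y ^ (-u.re - 1) * fejerDefect y))
    rw [← integral_const_mul]
    exact setIntegral_mono_on (hFint k).norm (hT.const_mul _) measurableSet_Ioi (hbound k)
  have hsum := hasSum_integral_of_summable_integral_norm hFint hFsum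
  have hD : ∫ y in Ioi (0 : ℝ), ∑' k, F k y
      = ∫ y in Ioi (0 : ℝ), (y : ℂ) ^ (-u - 1) * moebiusDensity c y := by
    refine integral_congr_ae (Eventually.of_forall fun y => ?_)
    simp only [F]
    rw [tsum_mul_left, moebiusDensity, Complex.ofReal_tsum]
  have hterm : ∀ k, ∫ y in Ioi (0 : ℝ), F k y
      = LSeries.term (fun k => (ArithmeticFunction.moebius k : ℂ)) (c + 2 * u) k * K := fun k => by
    rcases Nat.eq_zero_or_pos k with rfl | hk
    · simp [F, ha]
    have hkc : (k : ℂ) ≠ 0 := by exact_mod_cast hk.ne'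
    have hk2 : (0 : ℝ) < ((k : ℝ) ^ 2)⁻¹ := by positivity
    have hs := mellin_comp_mul_left (fun y => (fejerDefect y : ℂ)) (-u) hk2
    rw [LSeries.term_of_ne_zero hk.ne', hK, ← integral_cpow_mul_fejerDefect h0 h2]
    have e1 : ∫ y in Ioi (0 : ℝ), F k y
        = a k * mellin (fun y : ℝ => (fejerDefect (((k : ℝ) ^ 2)⁻¹ * y) : ℂ)) (-u) := by
      rw [mellin, ← integral_const_mul]
      refine integral_congr_ae (Eventually.of_forall fun y => ?_)
      simp only [F, smul_eq_mul, div_eq_inv_mul, Complex.ofReal_mul]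
      ring
    rw [e1, hs, neg_neg, mellin]
    simp only [smul_eq_mul]
    rw [← mul_assoc]
    congr 1
    have e2 : (((((k : ℝ) ^ 2)⁻¹ : ℝ)) : ℂ) ^ u = (k : ℂ) ^ (-(2 * u)) := by
      rw [Complex.cpow_neg, Complex.ofReal_inv, Complex.inv_cpow, Complex.ofReal_pow,
        Complex.ofReal_natCast]
      · congr 1
        rw [← Complex.natCast_cpow_natCast_mul]
        norm_num
      · rw [Complex.arg_ofReal_of_nonneg (by positivity)]
        exact Real.pi_pos.ne
    rw [e2]
    simp only [ha]
    rw [Complex.ofReal_mul, Complex.ofReal_cpow (by positivity), div_eq_mul_inv, ← Complex.cpow_neg,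
      neg_add, Complex.cpow_add _ _ hkc]
    push_cast
    ring
  simp_rw [hterm] at hsum
  rw [← hD, ← hsum.tsum_eq, tsum_mul_right]
  have hre : 1 < ((c : ℂ) + 2 * u).re := by
    simp
    linarith
  have hL := ArithmeticFunction.LSeries_zeta_mul_Lseries_moebius hre
  rw [ArithmeticFunction.LSeries_zeta_eq_riemannZeta hre] at hL
  have hζ := riemannZeta_ne_zero_of_one_lt_re hre
  rw [eq_div_iff hζ]
  change LSeries _ _ * K * _ = K
  linear_combination K * hL

/-- Positivity of the Möbius density makes the zeta factor a Fourier transform. -/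
theorem isFourierTransform_inv_sin_mul_Gamma_mul_zeta {c σ : ℝ} (hc : 4 ≤ c) (h0 : 0 < σ)
    (h2 : σ < 2) :
    IsFourierTransform (fun t => Real.pi / (2 * Complex.sin (Real.pi * (σ + t / 2 * Complex.I) / 2)
      * Complex.Gamma (σ + t / 2 * Complex.I + 3))
        / riemannZeta (c + 2 * (σ + t / 2 * Complex.I))) := by
  -- At `u = σ + it/2`, `y^(-u-1)` is `y^(-σ-1)` times the phase `exp(-it log y / 2)`.
  have hF := isFourierTransform_integral (g := fun y => -Real.log y / 2)
    (integrableOn_rpow_mul_moebiusDensity hc h0 h2)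
    (by
      filter_upwards [ae_restrict_mem measurableSet_Ioi] with y (hy : 0 < y)
      exact mul_nonneg (by positivity) (moebiusDensity_nonneg hc hy)) (by fun_prop)
  convert hF using 2 with t
  have hre : ((σ : ℂ) + t / 2 * Complex.I).re = σ := by simp
  have him : ((σ : ℂ) + t / 2 * Complex.I).im = t / 2 := by simp
  rw [← integral_cpow_mul_moebiusDensity hc (by rw [hre]; exact h0) (by rw [hre]; exact h2)]
  refine setIntegral_congr_fun measurableSet_Ioi fun y hy => ?_
  rw [ofReal_cpow_eq_rpow_mul_exp hy, Complex.sub_re, Complex.sub_im, Complex.neg_re,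
    Complex.neg_im, hre, him, Complex.one_re, Complex.one_im, Complex.ofReal_mul, mul_assoc,
    mul_comm (Complex.exp _), ← mul_assoc]
  congr 2
  push_cast
  ring

/-! ### The rational and Gamma factors -/

theorem isFourierTransform_one_div {p : ℝ} (hp : 0 < p) :
    IsFourierTransform (fun t => 1 / (p + t * Complex.I)) := by
  have hi : IntegrableOn (fun y : ℝ => Real.exp (-p * y)) (Ioi 0) :=
    integrableOn_exp_mul_Ioi (by simpa using hp) 0
  have hF := isFourierTransform_integral (g := fun y => -y) hi
    (Eventually.of_forall fun y => (Real.exp_pos _).le) (by fun_prop)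
  convert hF using 2 with t
  have h := integral_exp_mul_complex_Ioi (a := -(p + t * Complex.I)) (by simpa using hp) 0
  simp only [Complex.ofReal_zero, mul_zero, Complex.exp_zero, neg_div_neg_eq] at h
  rw [← h]
  refine setIntegral_congr_fun measurableSet_Ioi fun y hy => ?_
  rw [Complex.ofReal_exp, ← Complex.exp_add]
  congr 1
  push_cast
  ring

/-- For `b > 0` the quotient is `B(u, b)/Γ(b)`, whose integrand is a positive Beta weight times the
phase `exp(it log x / 2)`; for `b = 0` it is constantly `1`, the transform of a point mass at `0`.
-/
theorem isFourierTransform_Gamma_div_Gamma {σ b : ℝ} (hσ : 0 < σ) (hb : 0 ≤ b) :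
    IsFourierTransform (fun t => Complex.Gamma (σ + t / 2 * Complex.I)
      / Complex.Gamma (σ + t / 2 * Complex.I + b)) := by
  have hre : ∀ t : ℝ, ((σ : ℂ) + t / 2 * Complex.I).re = σ := fun t => by simp
  have him : ∀ t : ℝ, ((σ : ℂ) + t / 2 * Complex.I).im = t / 2 := fun t => by simp
  rcases hb.eq_or_lt with rfl | hb
  · convert isFourierTransform_exp 0 using 2 with t
    have : Complex.Gamma (σ + t / 2 * Complex.I) ≠ 0 :=
      Complex.Gamma_ne_zero_of_re_pos (by rw [hre]; exact hσ)
    simp [this]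
  have hreal : ∀ x ∈ Ioc (0 : ℝ) 1, (x : ℂ) ^ ((σ : ℂ) - 1) * (1 - (x : ℂ)) ^ ((b : ℂ) - 1)
      = ((x ^ (σ - 1) * (1 - x) ^ (b - 1) : ℝ) : ℂ) := fun x hx => by
    rw [Complex.ofReal_mul, Complex.ofReal_cpow hx.1.le,
      Complex.ofReal_cpow (by linarith [hx.2])]
    push_cast
    rfl
  have hi : IntegrableOn (fun x : ℝ => x ^ (σ - 1) * (1 - x) ^ (b - 1)) (Ioc 0 1) := by
    have h := Complex.betaIntegral_convergent (u := σ) (v := b) (by simpa) (by simpa)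
    rw [intervalIntegrable_iff_integrableOn_Ioc_of_le zero_le_one] at h
    have h' := h.congr_fun hreal measurableSet_Ioc
    have h2 := h'.re
    simp only [RCLike.re_to_complex, Complex.ofReal_re] at h2
    exact h2
  have hF := (isFourierTransform_integral (g := fun y => Real.log y / 2) hi
    (by
      filter_upwards [ae_restrict_mem measurableSet_Ioc] with x hx
      have : 0 ≤ 1 - x := by linarith [hx.2]
      have := hx.1.le
      change 0 ≤ _
      positivity) (by fun_prop)).const_mul (inv_nonneg.mpr (Real.Gamma_pos_of_pos hb).le)
  convert hF using 2 with t
  have hB := Complex.Gamma_mul_Gamma_eq_betaIntegral (s := σ + t / 2 * Complex.I) (t := b)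
    (by rw [hre]; exact hσ) (by simpa)
  have hG : Complex.Gamma (σ + t / 2 * Complex.I + b) ≠ 0 :=
    Complex.Gamma_ne_zero_of_re_pos (by
      rw [Complex.add_re, hre, Complex.ofReal_re]
      positivity)
  have hGb : Complex.Gamma b ≠ 0 := Complex.Gamma_ne_zero_of_re_pos (by simpa)
  have hI : Complex.betaIntegral (σ + t / 2 * Complex.I) b
      = ∫ x in Ioc (0 : ℝ) 1, ((x ^ (σ - 1) * (1 - x) ^ (b - 1) : ℝ) : ℂ)
        * Complex.exp (t * ((Real.log x / 2 : ℝ) : ℂ) * Complex.I) := by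
    rw [Complex.betaIntegral, intervalIntegral.integral_of_le zero_le_one]
    refine setIntegral_congr_fun measurableSet_Ioc fun x hx => ?_
    rw [← hreal x hx, ofReal_cpow_eq_rpow_mul_exp hx.1, ofReal_cpow_eq_rpow_mul_exp hx.1,
      Complex.sub_re, Complex.sub_im, hre, him]
    simp only [Complex.sub_re, Complex.sub_im, Complex.ofReal_re, Complex.ofReal_im,
      Complex.one_re, Complex.one_im]
    have hexp : Complex.exp (((t / 2 - 0 : ℝ) : ℂ) * Real.log x * Complex.I)
        = Complex.exp (t * ((Real.log x / 2 : ℝ) : ℂ) * Complex.I) := by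
      congr 1
      push_cast
      ring
    rw [hexp]
    simp only [sub_zero, Complex.ofReal_zero, zero_mul, Complex.exp_zero, mul_one]
    ring
  rw [← hI, Complex.ofReal_inv, ← Complex.Gamma_ofReal]
  rw [div_eq_iff hG, mul_assoc, eq_inv_mul_iff_mul_eq₀ hGb]
  linear_combination hB

/-! ### Factorisation of `n` and the case `x > 4` -/

/-- The factor `w/2` is absorbed into `Γ(w/2 + 1)`, whose argument is written as `u + 3 + b` so that
`Γ(u + 3)` can be inserted and cancelled between two factors. -/
theorem n_eq {k : ℕ} {u : ℂ} {β : ℝ} (h : 1 < (2 * (β : ℂ) + (4 * k + 2 * u)).re) :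
    n (4 * k + 2 * u) β = (-1) ^ k * Complex.sin (Real.pi * u / 2) *
      (2 * (2 * β + (4 * k + 2 * u) - 1) * (Real.pi : ℂ) ^ (-((2 * β + (4 * k + 2 * u)) / 2))
        * Complex.Gamma (u + 3 + (β + 2 * k - 2 : ℝ))
        * riemannZeta (2 * β + (4 * k + 2 * u))) := by
  have hsin : Complex.sin (Real.pi * (4 * k + 2 * u) / 4)
      = (-1) ^ k * Complex.sin (Real.pi * u / 2) := by
    rw [← Complex.sin_antiperiodic.add_nat_mul_eq]
    congr 1
    ring
  set w : ℂ := 2 * (β : ℂ) + (4 * k + 2 * u) with hw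
  have hw0 : w ≠ 0 := fun h0 => by rw [h0] at h; norm_num at h
  have hG : Complex.Gamma (u + 3 + (β + 2 * k - 2 : ℝ)) = w / 2 * Complex.Gamma (w / 2) := by
    rw [← Complex.Gamma_add_one _ (div_ne_zero hw0 two_ne_zero)]
    congr 1
    rw [hw]
    push_cast
    ring
  rw [n, hsin, xi_eq w, hG]
  · rw [neg_div]
    ring
  · intro h1
    rw [h1] at h
    norm_num at h
  · intro j hj
    rw [hj] at h
    simp at h
    have : (0 : ℝ) ≤ j := by positivity
    linarith

theorem sin_pi_mul_div_two_ne_zero {u : ℂ} (h0 : 0 < u.re) (h2 : u.re < 2) :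
    Complex.sin (Real.pi * u / 2) ≠ 0 := by
  rw [Complex.sin_ne_zero_iff]
  intro j hj
  have hπ : (Real.pi : ℂ) ≠ 0 := by exact_mod_cast Real.pi_ne_zero
  have hu : u = 2 * j := by
    field_simp at hj
    rw [hj, mul_comm]
  have hr : u.re = 2 * j := by rw [hu]; simp
  rw [hr] at h0 h2
  have h3 : (0 : ℝ) < j := by linarith
  have h4 : (j : ℝ) < 1 := by linarith
  have h3' : 0 < j := by exact_mod_cast h3
  have h4' : j < 1 := by exact_mod_cast h4
  omega

theorem metricAssertions_of_four_lt {β x : ℝ} (hβ : 0 ≤ β) (hx : 4 < x)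
    (hk : ∀ k : ℤ, x ≠ 4 * (k : ℝ)) : MetricAssertions x β := by
  obtain ⟨k, σ, hk1, hσ0, hσ2, rfl⟩ :
      ∃ (k : ℕ) (σ : ℝ), 1 ≤ k ∧ 0 < σ ∧ σ < 2 ∧ x = 4 * k + 2 * σ := by
    have h1 := Nat.floor_le (show 0 ≤ x / 4 by linarith)
    have h2 := Nat.lt_floor_add_one (x / 4)
    have h3 : (⌊x / 4⌋₊ : ℝ) ≠ x / 4 := fun h => hk ⌊x / 4⌋₊ (by push_cast; linarith)
    have h4 := lt_of_le_of_ne h1 h3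
    refine ⟨⌊x / 4⌋₊, (x - 4 * ⌊x / 4⌋₊) / 2, Nat.le_floor (by push_cast; linarith), ?_, ?_, ?_⟩
    · linarith
    · linarith
    · ring
  have hkR : (1 : ℝ) ≤ k := by exact_mod_cast hk1
  set p : ℝ := 2 * β + 4 * k + 2 * σ - 1 with hp
  have hp0 : 0 < p := by rw [hp]; linarith
  have hF1 := isFourierTransform_one_div hp0
  -- `k ≥ 1` gives both `b = β + 2k - 2 ≥ 0` and `c = 2β + 4k ≥ 4`.
  have hQ' := ((isFourierTransform_exp (Real.log Real.pi / 2)).mul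
    (isFourierTransform_Gamma_div_Gamma (σ := σ + 3) (b := β + 2 * k - 2) (by linarith)
      (by linarith))).mul
    (isFourierTransform_inv_sin_mul_Gamma_mul_zeta (c := 2 * β + 4 * k) (σ := σ) (by linarith)
      hσ0 hσ2)
  set Q : ℝ → ℂ := fun t => _ with hQdef
  have hQ : IsFourierTransform Q := hQ'
  have hπ : (Real.pi : ℂ) ≠ 0 := by exact_mod_cast Real.pi_ne_zero
  have harg : ∀ t : ℝ, ((4 * k + 2 * σ : ℝ) : ℂ) + Complex.I * t
      = 4 * k + 2 * (σ + t / 2 * Complex.I) := fun t => by push_cast; ring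
  have hure : ∀ t : ℝ, ((σ : ℂ) + t / 2 * Complex.I).re = σ := fun t => by simp
  have hwre : ∀ t : ℝ, 1 < (2 * (β : ℂ) + (4 * k + 2 * (σ + t / 2 * Complex.I))).re := fun t => by
    simp
    linarith
  have hsin : ∀ t : ℝ, Complex.sin (Real.pi * (σ + t / 2 * Complex.I) / 2) ≠ 0 := fun t =>
    sin_pi_mul_div_two_ne_zero (by rwa [hure]) (by rwa [hure])
  have hw1 : ∀ t : ℝ, 2 * (β : ℂ) + (4 * k + 2 * (σ + t / 2 * Complex.I)) - 1 ≠ 0 :=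
    fun t h => by
      have := hwre t
      rw [sub_eq_zero.mp h] at this
      norm_num at this
  have hpow : ∀ w : ℂ, (Real.pi : ℂ) ^ w ≠ 0 := fun w => by simp [Complex.cpow_eq_zero_iff, hπ]
  have hG : ∀ t : ℝ,
      Complex.Gamma (σ + t / 2 * Complex.I + 3 + (β + 2 * k - 2 : ℝ)) ≠ 0 := fun t =>
    Complex.Gamma_ne_zero_of_re_pos (by
      simp
      linarith)
  have hG3 : ∀ t : ℝ, Complex.Gamma (σ + t / 2 * Complex.I + 3) ≠ 0 := fun t =>
    Complex.Gamma_ne_zero_of_re_pos (by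
      simp
      linarith)
  have hζ := fun t : ℝ => riemannZeta_ne_zero_of_one_lt_re (hwre t)
  have hne : ∀ t : ℝ, n (((4 * k + 2 * σ : ℝ) : ℂ) + Complex.I * (t : ℂ)) (β : ℂ) ≠ 0 := fun t => by
    rw [harg, n_eq (hwre t)]
    exact mul_ne_zero (mul_ne_zero (pow_ne_zero _ (by norm_num)) (hsin t))
      (mul_ne_zero (mul_ne_zero (mul_ne_zero (mul_ne_zero two_ne_zero (hw1 t)) (hpow _)) (hG t))
        (hζ t))
  have hn : ∀ t : ℝ, (n (((4 * k + 2 * σ : ℝ) : ℂ) + Complex.I * (t : ℂ)) (β : ℂ))⁻¹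
      = ((-1) ^ k * (Real.pi : ℂ) ^ (β + 2 * k + σ : ℂ) / Real.pi)
        * (1 / (p + t * Complex.I) * Q t) := fun t => by
    have e1 : (p : ℂ) + t * Complex.I = 2 * β + (4 * k + 2 * (σ + t / 2 * Complex.I)) - 1 := by
      rw [hp]
      push_cast
      ring
    have e2 : Complex.exp (t * (Real.log Real.pi / 2 : ℝ) * Complex.I)
        = (Real.pi : ℂ) ^ (t / 2 * Complex.I) := by
      rw [Complex.cpow_def_of_ne_zero hπ, ← Complex.ofReal_log Real.pi_pos.le]
      congr 1
      push_cast
      ring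
    have e3 : (Real.pi : ℂ) ^ (-((2 * β + (4 * k + 2 * (σ + t / 2 * Complex.I))) / 2) : ℂ)
        = ((Real.pi : ℂ) ^ (β + 2 * k + σ : ℂ) * (Real.pi : ℂ) ^ (t / 2 * Complex.I))⁻¹ := by
      rw [← Complex.cpow_add _ _ hπ, ← Complex.cpow_neg]
      congr 1
      ring
    have e4 : ((2 * β + 4 * k : ℝ) : ℂ) + 2 * (σ + t / 2 * Complex.I)
        = 2 * β + (4 * k + 2 * (σ + t / 2 * Complex.I)) := by
      push_cast
      ring
    have e5 : ((σ + 3 : ℝ) : ℂ) + t / 2 * Complex.I = σ + t / 2 * Complex.I + 3 := by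
      push_cast
      ring
    have e6 : ((-1 : ℂ) ^ k) * (-1) ^ k = 1 := by rw [← mul_pow]; norm_num
    simp only [hQdef]
    rw [harg, n_eq (hwre t), e1, e2, e3, e4, e5]
    have h1 := hsin t
    have h2 := hw1 t
    have h3 := hG t
    have h4 := hG3 t
    have h5 := hζ t
    have h6 := hpow (t / 2 * Complex.I)
    have h7 := hpow (β + 2 * k + σ)
    generalize Complex.sin (Real.pi * (σ + t / 2 * Complex.I) / 2) = S at *
    generalize riemannZeta _ = Z at *
    generalize Complex.Gamma (σ + t / 2 * Complex.I + 3 + (β + 2 * k - 2 : ℝ)) = A at *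
    generalize Complex.Gamma (σ + t / 2 * Complex.I + 3) = B at *
    generalize (2 * (β : ℂ) + (4 * k + 2 * (σ + t / 2 * Complex.I)) - 1) = W at *
    generalize (Real.pi : ℂ) ^ (t / 2 * Complex.I) = X at *
    generalize (Real.pi : ℂ) ^ (β + 2 * k + σ : ℂ) = Y at *
    have h8 : ((-1 : ℂ) ^ k) ≠ 0 := pow_ne_zero _ (by norm_num)
    generalize (-1 : ℂ) ^ k = V at *
    field_simp
    linear_combination -e6
  refine metricAssertions_of_isFourierTransform (hF1.mul hQ) (fun t ht => ?_) hn hne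
  have hQ0 : Q 0 ≠ 0 := fun h => by
    have h0 := hn 0
    rw [h, mul_zero, mul_zero] at h0
    exact inv_ne_zero (hne 0) h0
  -- Strict decrease comes from this factor alone; for `Q` the bound `‖Q t‖ ≤ ‖Q 0‖` suffices.
  have h1 : ‖1 / ((p : ℂ) + t * Complex.I)‖ < ‖1 / ((p : ℂ) + (0 : ℝ) * Complex.I)‖ := by
    have h2 : |((p : ℂ) + t * Complex.I).re| < ‖(p : ℂ) + t * Complex.I‖ :=
      Complex.abs_re_lt_norm.mpr (by simpa using ht)
    rw [norm_div, norm_div, norm_one]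
    refine one_div_lt_one_div_of_lt ?_ ?_
    · simpa using hp0.ne'
    · simpa using h2
  change ‖1 / ((p : ℂ) + t * Complex.I) * Q t‖ < ‖1 / ((p : ℂ) + (0 : ℝ) * Complex.I) * Q 0‖
  rw [norm_mul _ (Q t), norm_mul _ (Q 0)]
  exact (mul_le_mul_of_nonneg_left (hQ.norm_le t) (norm_nonneg _)).trans_lt
    (mul_lt_mul_of_pos_right h1 (norm_pos_iff.mpr hQ0))

/-! ### The functional equation and `β = 1/4` -/

theorem xi_one_sub (s : ℂ) : xi (1 - s) = xi s := by
  rw [xi, xi, completedRiemannZeta₀_one_sub]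
  ring

/-- At `2β = 1/2` negating `s` reflects the argument of `ξ` about the critical line's centre,
leaving `ξ` unchanged, while the sine is odd. -/
theorem n_neg_quarter (s : ℂ) : n (-s) ((1 / 4 : ℝ) : ℂ) = -n s ((1 / 4 : ℝ) : ℂ) := by
  have h : 2 * ((1 / 4 : ℝ) : ℂ) + -s = 1 - (2 * ((1 / 4 : ℝ) : ℂ) + s) := by
    push_cast
    ring
  rw [n, n, h, xi_one_sub, mul_neg, neg_div, Complex.sin_neg, neg_mul]

/-- The signs cancel in the quotient, so `m` at `(x, t)` equals `m` at `(-x, -t)`, and evenness in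
`t` removes the second sign. -/
theorem metricAssertions_quarter_neg {x : ℝ} (h : MetricAssertions (-x) (1 / 4)) :
    MetricAssertions x (1 / 4) := by
  have hn : ∀ t : ℝ, n ((x : ℂ) + Complex.I * t) ((1 / 4 : ℝ) : ℂ)
      = -n (((-x : ℝ) : ℂ) + Complex.I * ((-t : ℝ) : ℂ)) ((1 / 4 : ℝ) : ℂ) := fun t => by
    rw [← n_neg_quarter]
    congr 1
    push_cast
    ring
  have hn0 : n (x : ℂ) ((1 / 4 : ℝ) : ℂ) = -n ((-x : ℝ) : ℂ) ((1 / 4 : ℝ) : ℂ) := by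
    simpa using hn 0
  obtain ⟨h1, ⟨N, hN⟩, h3, h4⟩ := h
  have hm : m x (1 / 4) = m (-x) (1 / 4) := by
    ext t
    have : m x (1 / 4) t = m (-x) (1 / 4) (-t) := by
      rw [m, m, hn, hn0, neg_div_neg_eq]
    rw [this, ← hN, ← hN, map_neg_eq_map]
  have hd : d x (1 / 4) = d (-x) (1 / 4) := by
    ext s t
    rw [d, d, hm]
  refine ⟨fun t => ?_, ⟨N, fun t => by rw [hN, hm]⟩, by rwa [hd], by rwa [hd]⟩
  rw [hn]
  exact neg_ne_zero.mpr (h1 _)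

end CsizmaziaZeta

theorem corollary6p2 :
    (∀ β x : ℝ, 0 ≤ β → 4 < x → (∀ k : ℤ, x ≠ 4 * (k : ℝ)) →
      CsizmaziaZeta.MetricAssertions x β) ∧
    (∀ x : ℝ, 4 < |x| → (∀ k : ℤ, x ≠ 4 * (k : ℝ)) →
      CsizmaziaZeta.MetricAssertions x (1 / 4)) := by
  refine ⟨fun β x hβ hx hk => CsizmaziaZeta.metricAssertions_of_four_lt hβ hx hk,
    fun x hx hk => ?_⟩
  rcases lt_abs.mp hx with h | h
  · exact CsizmaziaZeta.metricAssertions_of_four_lt (by norm_num) h hk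
  · refine CsizmaziaZeta.metricAssertions_quarter_neg
      (CsizmaziaZeta.metricAssertions_of_four_lt (by norm_num) h fun k hk' => hk (-k) ?_)
    push_cast
    linarith
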